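/- Let $n\in\mathbb{N}$, let $\mathbf{A},\mathbf{B},\mathbf{\Omega}\in\mathbb{R}^{n\times n}$, where $\mathbf{B}$ has zero diagonal and $\mathbf{\Omega}$ is diagonal with positive diagonal entries, and suppose that $\mathbf{A}\sim(\mathbf{I}-\mathbf{B})\mathbf{\Omega}^{-1/2}$, i.e., the two matrices differ only by a permutation of the columns and sign changes of columns. Let $\mathcal{G}_{\mathbf{B}}$ be the directed graph on $\{1,\dots,n\}$ with an edge $j\to i$ if and only if $B_{j,i}\neq 0$. Then the following are equivalent. 1. $\mathbf{A}$ satisfies both - (structural variability) for all $i\neq j$, the supports of the columns $\mathbf{a}_i,\mathbf{a}_j$ of $\mathbf{A}$ satisfy $|\operatorname{supp}(\mathbf{a}_i)\cup\operatorname{supp}(\mathbf{a}_j)|-|\operatorname{supp}(\mathbf{a}_i)\cap\operatorname{supp}(\mathbf{a}_j)|>1$; and - (permutations to lower triangular) there are permutation matrices $\mathbf{P}_1,\mathbf{P}_2$ such that $\mathbf{P}_1^\top\mathbf{A}\mathbf{P}_2$ is lower triangular. 2. $\mathcal{G}_{\mathbf{B}}$ is a DAG (it has no directed cycle), and its Markov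 equivalence class is a singleton. Here two DAGs on the same vertex set are Markov equivalent if they have the same skeleton (underlying undirected graph) and the same v-structures (triples $a\to c\leftarrow b$ with $a\neq b$ non-adjacent), and the Markov equivalence class of a DAG is the set of all DAGs on its vertex set that are Markov equivalent to it. -/

import Mathlib

namespace SparseICA

section Matrices

variable {n : ℕ}

/-- `A ∼ M`: the two matrices differ only in a permutation and sign changes of the columns. -/
def SignedColPermEquiv (A M : Matrix (Fin n) (Fin n) ℝ) : Prop :=
  ∃ (σ : Equiv.Perm (Fin n)) (s : Fin n → ℝ), (∀ j, s j = 1 ∨ s j = -1) ∧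
    A = M * σ.permMatrix ℝ * Matrix.diagonal s

/-- The matrix `Ω` is diagonal with positive diagonal entries. -/
def IsPosDiagonal (Ω : Matrix (Fin n) (Fin n) ℝ) : Prop :=
  Ω.IsDiag ∧ ∀ i, 0 < Ω i i

/-- `Ω^{-1/2}` for a positive diagonal matrix `Ω`. -/
noncomputable def invSqrtDiag (Ω : Matrix (Fin n) (Fin n) ℝ) : Matrix (Fin n) (Fin n) ℝ :=
  Matrix.diagonal fun i => (Real.sqrt (Ω i i))⁻¹

/-- The support of the `j`-th column of `A`. -/
def colSupport (A : Matrix (Fin n) (Fin n) ℝ) (j : Fin n) : Set (Fin n) :=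
  {k | A k j ≠ 0}

/-- Structural variability: the supports of every two columns differ in more than one entry. -/
def StructuralVariability (A : Matrix (Fin n) (Fin n) ℝ) : Prop :=
  ∀ i j : Fin n, i ≠ j →
    (1 : ℤ) < ((colSupport A i ∪ colSupport A j).ncard : ℤ)
      - ((colSupport A i ∩ colSupport A j).ncard : ℤ)

/-- Separate row and column permutations make `A` lower triangular. -/
def PermutableToLowerTriangular (A : Matrix (Fin n) (Fin n) ℝ) : Prop :=
  ∃ σ τ : Equiv.Perm (Fin n),
    ((σ.permMatrix ℝ).transpose * A * τ.permMatrix ℝ).IsLowerTriangular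

/-- The directed graph with weighted adjacency matrix `B`: there is an edge `j → i` exactly if
`B j i ≠ 0`. -/
def graphOf (B : Matrix (Fin n) (Fin n) ℝ) : Digraph (Fin n) where
  Adj j i := B j i ≠ 0

end Matrices

section Graphs

variable {V : Type*}

/-- A directed graph is a DAG if it has no directed cycle (self-loops included). -/
def IsDAG (G : Digraph V) : Prop :=
  ∀ v, ¬ Relation.TransGen G.Adj v v

/-- The skeleton: the undirected graph obtained by forgetting the orientation of the edges. -/
def skeleton (G : Digraph V) : SimpleGraph V :=
  G.toSimpleGraphInclusive

/-- `a → c ← b` is a v-structure: `a ≠ b` are non-adjacent parents of `c`. -/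
def IsVStructure (G : Digraph V) (a c b : V) : Prop :=
  a ≠ b ∧ G.Adj a c ∧ G.Adj b c ∧ ¬ (skeleton G).Adj a b

/-- Two graphs are Markov equivalent if they have the same skeleton and the same v-structures. -/
def MarkovEquivalent (G H : Digraph V) : Prop :=
  skeleton G = skeleton H ∧ ∀ a c b, IsVStructure G a c b ↔ IsVStructure H a c b

/-- The Markov equivalence class of `G`: all DAGs on the same vertices Markov equivalent to `G`. -/
def markovEquivalenceClass (G : Digraph V) : Set (Digraph V) :=
  {H | IsDAG H ∧ MarkovEquivalent G H}

end Graphs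

end SparseICA

/-!
In the matrix `(1 - B) Ω^{-1/2}` the support of column `i` is the closed parent set
`{i} ∪ pa(i)` of the vertex `i` in the graph of `B`, and passing to `A` only permutes these sets.

*Triangularity is acyclicity.* A topological order of the graph makes `A` triangular. Conversely,
the diagonal of `1 - B` is a transversal of nonzero entries, and in a triangular pattern the only
such transversal is the diagonal. Hence the row and the column permutation order the vertices in
the same way, which is a topological order (`isDAG_of_triangular`).

*Structural variability is the absence of covered edges.* In a DAG the closed parent sets of
`x ≠ y` differ in at most one element exactly if one of the edges `x → y`, `y → x` is present and
covered: the parents of its head are its tail and the parents of its tail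
(`forall_nontrivial_iff_no_coveredEdge`).

*A DAG is alone in its Markov equivalence class exactly if it has no covered edge.* Reversing a
covered edge gives another DAG in the class (`IsDAG.reverseEdge`, `CoveredEdge.markovEquivalent`).
If two different DAGs are equivalent, choose an edge `x → y` of the first that the second reverses,
with `y` as early and then `x` as late as possible in a topological order of the first; Chickering's
argument shows that this edge is covered (`exists_coveredEdge`).
-/

namespace SparseICA

section Graphs

variable {V : Type*} {G H : Digraph V}

/-! ### Directed acyclic graphs and rank functions -/

theorem isDAG_of_rank (f : V → ℤ) (hf : ∀ a b, G.Adj a b → f a < f b) : IsDAG G := by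
  intro v hv
  have key : ∀ a b, Relation.TransGen G.Adj a b → f a < f b := by
    intro a b hab
    induction hab with
    | single h => exact hf _ _ h
    | tail _ h ih => exact ih.trans (hf _ _ h)
  exact lt_irrefl _ (key v v hv)

/-- A finite DAG has a topological order; the rank of a vertex is its number of ancestors. -/
theorem IsDAG.exists_rank [Finite V] (hG : IsDAG G) :
    ∃ f : V → ℤ, ∀ a b, G.Adj a b → f a < f b := by
  refine ⟨fun v => ({u | Relation.TransGen G.Adj u v}.ncard : ℤ), fun a b hab => ?_⟩
  refine Int.ofNat_lt.mpr (Set.ncard_lt_ncard ?_ (Set.toFinite _))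
  refine ⟨fun u hu => Relation.TransGen.tail hu hab, fun hsub => ?_⟩
  exact hG a (hsub (Relation.TransGen.single hab))

theorem IsDAG.irrefl (hG : IsDAG G) (a : V) : ¬ G.Adj a a :=
  fun h => hG a (.single h)

theorem IsDAG.asymm (hG : IsDAG G) {a b : V} (h : G.Adj a b) : ¬ G.Adj b a :=
  fun h' => hG a (.tail (.single h) h')

theorem skeleton_adj (a b : V) :
    (skeleton G).Adj a b ↔ a ≠ b ∧ (G.Adj a b ∨ G.Adj b a) := by
  simp [skeleton, Digraph.toSimpleGraphInclusive, SimpleGraph.fromRel_adj]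

theorem mem_markovEquivalenceClass_self (hG : IsDAG G) : G ∈ markovEquivalenceClass G :=
  ⟨hG, rfl, fun _ _ _ => Iff.rfl⟩

/-! ### Covered edges -/

/-- The edge `x → y` is covered: the parents of `y` are exactly `x` and the parents of `x`. -/
def CoveredEdge (G : Digraph V) (x y : V) : Prop :=
  G.Adj x y ∧ ∀ z, G.Adj z y ↔ z = x ∨ G.Adj z x

/-- The digraph `G` with the edge `x → y` replaced by `y → x`. -/
def reverseEdge (G : Digraph V) (x y : V) : Digraph V where
  Adj a b := (G.Adj a b ∧ ¬ (a = x ∧ b = y)) ∨ (a = y ∧ b = x)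

theorem reverseEdge_adj (x y a b : V) :
    (reverseEdge G x y).Adj a b ↔ (G.Adj a b ∧ ¬ (a = x ∧ b = y)) ∨ (a = y ∧ b = x) :=
  Iff.rfl

/-- Reversing a covered edge `x → y` keeps a finite DAG acyclic: in a topological order the vertex
`y` can be moved to the place immediately before `x`. -/
theorem IsDAG.reverseEdge [Finite V] (hG : IsDAG G) {x y : V} (h : CoveredEdge G x y) :
    IsDAG (reverseEdge G x y) := by
  classical
  obtain ⟨f, hf⟩ := hG.exists_rank
  have hxy := hf _ _ h.1
  -- Doubling the ranks leaves room for `y` just below `x`.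
  refine isDAG_of_rank (fun v => if v = y then 2 * f x - 1 else 2 * f v) fun a b hab => ?_
  rcases (reverseEdge_adj x y a b).1 hab with ⟨hadj, hne⟩ | ⟨rfl, rfl⟩
  · have hlt := hf a b hadj
    by_cases hb : b = y
    · subst hb
      have hax : a ≠ x := fun e => hne ⟨e, rfl⟩
      have hlt' := hf a x (((h.2 a).1 hadj).resolve_left hax)
      have hab' : a ≠ b := fun e => by simp [e] at hlt
      simp only [hab', if_true, if_false]
      omega
    · by_cases ha : a = y
      · subst ha
        simp only [hb, if_true, if_false]
        omega
      · simp only [ha, hb, if_false]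
        omega
  · have hba : b ≠ a := fun e => by simp [e] at hxy
    simp only [hba, if_true, if_false]
    omega

theorem CoveredEdge.markovEquivalent (hG : IsDAG G) {x y : V} (h : CoveredEdge G x y) :
    MarkovEquivalent G (SparseICA.reverseEdge G x y) := by
  obtain ⟨hxy, hcov⟩ := h
  have hne : x ≠ y := fun e => hG.irrefl y (e ▸ hxy)
  have hyx := hG.asymm hxy
  have hskel : ∀ a b, (skeleton G).Adj a b ↔ (skeleton (SparseICA.reverseEdge G x y)).Adj a b := by
    intro a b
    simp only [skeleton_adj, reverseEdge_adj]
    grind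
  refine ⟨by ext a b; exact hskel a b, fun a c b => ?_⟩
  simp only [IsVStructure, ← hskel]
  simp only [skeleton_adj, reverseEdge_adj]
  grind

/-- Two different Markov equivalent DAGs disagree on an edge that is covered in the first one. -/
theorem exists_coveredEdge [Finite V] (hG : IsDAG G) (hH : IsDAG H) (he : MarkovEquivalent G H)
    (hne : H ≠ G) : ∃ x y, CoveredEdge G x y := by
  obtain ⟨f, hf⟩ := hG.exists_rank
  obtain ⟨hskel, hv⟩ := he
  have hs : ∀ a b, (a ≠ b ∧ (G.Adj a b ∨ G.Adj b a)) ↔ (a ≠ b ∧ (H.Adj a b ∨ H.Adj b a)) := by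
    intro a b
    rw [← skeleton_adj, ← skeleton_adj, hskel]
  have hGne : ∀ a b, G.Adj a b → a ≠ b := fun a b h e => hG.irrefl b (e ▸ h)
  have hHne : ∀ a b, H.Adj a b → a ≠ b := fun a b h e => hH.irrefl b (e ▸ h)
  have hGH : ∀ a b, G.Adj a b → H.Adj a b ∨ H.Adj b a := fun a b h =>
    ((hs a b).1 ⟨hGne a b h, .inl h⟩).2
  have hHG : ∀ a b, H.Adj a b → G.Adj a b ∨ G.Adj b a := fun a b h =>
    ((hs a b).2 ⟨hHne a b h, .inl h⟩).2
  have hex : ∃ y, ∃ x, G.Adj x y ∧ H.Adj y x := by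
    by_contra! hno
    refine hne (Digraph.ext ?_)
    funext a b
    refine propext ⟨fun h => ?_, fun h => ?_⟩
    · exact (hHG a b h).resolve_right fun h' => hno _ _ h' h
    · exact (hGH a b h).resolve_right (hno _ _ h)
  -- The head `y` is chosen as early as possible, then the tail `x` as late as possible.
  obtain ⟨y, ⟨x₀, hx₀⟩, hymin⟩ :=
    Set.exists_min_image {y | ∃ x, G.Adj x y ∧ H.Adj y x} f (Set.toFinite _) hex
  obtain ⟨x, ⟨hxy, hyx⟩, hxmax⟩ :=
    Set.exists_max_image {x | G.Adj x y ∧ H.Adj y x} f (Set.toFinite _) ⟨x₀, hx₀⟩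
  have hsame : ∀ a b, f b < f y → G.Adj a b → H.Adj a b := fun a b hb hab =>
    (hGH a b hab).resolve_right fun hba => (hymin b ⟨a, hab, hba⟩).not_gt hb
  refine ⟨x, y, hxy, fun z => ⟨fun hzy => ?_, ?_⟩⟩
  · by_cases hzx : z = x
    · exact .inl hzx
    have hadj : (skeleton G).Adj x z := by
      by_contra hno
      have hv' := (hv x y z).1 ⟨Ne.symm hzx, hxy, hzy, hno⟩
      exact hH.asymm hyx hv'.2.1
    rcases ((skeleton_adj x z).1 hadj).2 with hxz | hzx'
    · -- Otherwise `y → x → z → y` would be a cycle of `H`.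
      have hxzH := hsame x z (hf z y hzy) hxz
      have hzyH : H.Adj z y := (hGH z y hzy).resolve_right fun hyz =>
        (hxmax z ⟨hzy, hyz⟩).not_gt (hf x z hxz)
      exact (hH y (((Relation.TransGen.single hyx).tail hxzH).tail hzyH)).elim
    · exact .inr hzx'
  · rintro (rfl | hzx)
    · exact hxy
    have hzxH := hsame z x (hf x y hxy) hzx
    have hzylt := (hf z x hzx).trans (hf x y hxy)
    have hadj : (skeleton G).Adj z y := by
      by_contra hno
      have hzy : z ≠ y := fun e => by simp [e] at hzylt
      have hv' := (hv z x y).2 ⟨hzy, hzxH, hyx, hskel ▸ hno⟩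
      exact hG.asymm hxy hv'.2.2.1
    exact ((skeleton_adj z y).1 hadj).2.resolve_right fun hyz => (hf y z hyz).not_gt hzylt

theorem exists_markovEquivalenceClass_eq_singleton_iff [Finite V] (hG : IsDAG G) :
    (∃ K, markovEquivalenceClass G = {K}) ↔ ∀ x y, ¬ CoveredEdge G x y := by
  refine ⟨?_, fun h => ⟨G, Set.eq_singleton_iff_unique_mem.2
    ⟨mem_markovEquivalenceClass_self hG, fun H hH => ?_⟩⟩⟩
  · rintro ⟨K, hK⟩ x y hxy
    have hsub : (markovEquivalenceClass G).Subsingleton := hK ▸ Set.subsingleton_singleton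
    have heq : G = reverseEdge G x y := hsub (mem_markovEquivalenceClass_self hG)
      ⟨hG.reverseEdge hxy, hxy.markovEquivalent hG⟩
    refine hG.asymm hxy.1 ?_
    rw [heq]
    exact .inr ⟨rfl, rfl⟩
  · by_contra hne
    obtain ⟨x, y, hxy⟩ := exists_coveredEdge hG hH.1 hH.2 hne
    exact h x y hxy

/-! ### Closed parent sets -/

/-- The closed parent set of a vertex: the vertex together with its parents. -/
def closedParents (G : Digraph V) (i : V) : Set V :=
  {k | k = i ∨ G.Adj k i}

theorem forall_nontrivial_iff_no_coveredEdge (hG : IsDAG G) :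
    (∀ i j, i ≠ j → (symmDiff (closedParents G i) (closedParents G j)).Nontrivial) ↔
      ∀ x y, ¬ CoveredEdge G x y := by
  constructor
  · rintro h x y ⟨hxy, hcov⟩
    have hne : x ≠ y := fun e => hG.irrefl y (e ▸ hxy)
    refine Set.not_nontrivial_iff.2 ?_ (h x y hne)
    have hsub : symmDiff (closedParents G x) (closedParents G y) ⊆ {y} := by
      intro z hz
      simp only [closedParents, Set.mem_symmDiff, Set.mem_ofPred_eq] at hz
      have := hcov z
      simp only [Set.mem_singleton_iff]
      tauto
    exact Set.subsingleton_singleton.anti hsub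
  · intro h i j hij
    by_contra hsub
    rw [Set.not_nontrivial_iff] at hsub
    -- If `j` is not a parent of `i`, it is the only element in which the two sets differ.
    have key : ∀ i j, i ≠ j → ¬ G.Adj j i →
        (symmDiff (closedParents G i) (closedParents G j)).Subsingleton → False := by
      intro i j hij hji hsub
      have hj : j ∈ symmDiff (closedParents G i) (closedParents G j) :=
        .inr ⟨.inl rfl, fun e => e.elim (fun e => hij e.symm) hji⟩
      have hmem : ∀ z, z ≠ j → (z ∈ closedParents G i ↔ z ∈ closedParents G j) := by
        intro z hz
        by_contra hcon
        refine hz (hsub ?_ hj)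
        rw [Set.mem_symmDiff]
        tauto
      simp only [closedParents, Set.mem_ofPred_eq] at hmem
      refine h i j ⟨((hmem i hij).1 (.inl rfl)).resolve_left hij, fun z => ?_⟩
      by_cases hz : z = j
      · subst hz
        exact iff_of_false (hG.irrefl z) (by tauto)
      · have := hmem z hz
        tauto
    by_cases hji : G.Adj j i
    · exact key j i hij.symm (hG.asymm hji) (symmDiff_comm (closedParents G i) _ ▸ hsub)
    · exact key i j hij hji hsub

end Graphs

section Matrices

variable {n : ℕ}

/-! ### From matrices to the graph -/

theorem one_lt_ncard_union_sub_ncard_inter_iff {V : Type*} [Finite V] (S T : Set V) :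
    (1 : ℤ) < ((S ∪ T).ncard : ℤ) - ((S ∩ T).ncard : ℤ) ↔ (symmDiff S T).Nontrivial := by
  have h : (symmDiff S T).ncard + (S ∩ T).ncard = (S ∪ T).ncard := by
    rw [symmDiff_eq_sup_sdiff_inf]
    exact Set.ncard_sdiff_add_ncard_of_subset
      (Set.inter_subset_left.trans Set.subset_union_left) (Set.toFinite _)
  rw [← Set.one_lt_ncard_iff_nontrivial]
  omega

theorem permutableToLowerTriangular_iff (A : Matrix (Fin n) (Fin n) ℝ) :
    PermutableToLowerTriangular A ↔
      ∃ σ τ : Equiv.Perm (Fin n), ∀ i j, i < j → A (σ i) (τ j) = 0 := by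
  have hentry : ∀ (σ τ : Equiv.Perm (Fin n)) (i j : Fin n),
      ((σ.permMatrix ℝ).transpose * A * τ.permMatrix ℝ) i j = A (σ.symm i) (τ.symm j) := by
    intro σ τ i j
    rw [Matrix.transpose_permMatrix, PEquiv.mul_toMatrix_toPEquiv, PEquiv.toMatrix_toPEquiv_mul]
    rfl
  constructor
  · rintro ⟨σ, τ, h⟩
    exact ⟨σ.symm, τ.symm, fun i j hij => hentry σ τ i j ▸ h hij⟩
  · rintro ⟨σ, τ, h⟩
    refine ⟨σ.symm, τ.symm, fun i j hij => ?_⟩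
    rw [hentry]
    exact h i j hij

theorem SignedColPermEquiv.exists_ne_zero_iff {A B Ω : Matrix (Fin n) (Fin n) ℝ}
    (hB : ∀ i, B i i = 0) (hΩ : IsPosDiagonal Ω)
    (hA : SignedColPermEquiv A ((1 - B) * invSqrtDiag Ω)) :
    ∃ ρ : Equiv.Perm (Fin n), ∀ k j, A k j ≠ 0 ↔ k ∈ closedParents (graphOf B) (ρ j) := by
  obtain ⟨σ, s, hs, rfl⟩ := hA
  refine ⟨σ.symm, fun k j => ?_⟩
  have hsj : s j ≠ 0 := by rcases hs j with h | h <;> simp [h]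
  have hω : (Real.sqrt (Ω (σ.symm j) (σ.symm j)))⁻¹ ≠ 0 :=
    inv_ne_zero (Real.sqrt_pos.2 (hΩ.2 _)).ne'
  rw [Matrix.mul_diagonal, PEquiv.mul_toMatrix_toPEquiv, Matrix.submatrix_apply, invSqrtDiag,
    Matrix.mul_diagonal]
  simp only [id, ne_eq, mul_eq_zero, hsj, or_false, hω, Matrix.sub_apply, closedParents,
    graphOf, Set.mem_ofPred_eq]
  by_cases hk : k = σ.symm j
  · simp [hk, hB, Matrix.one_apply]
  · simp [hk]

/-- A permutation that moves no element upwards is the identity. -/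
theorem perm_apply_eq_of_le (π : Equiv.Perm (Fin n)) (h : ∀ i, π i ≤ i) (i : Fin n) : π i = i := by
  have hsum : ∑ i, (π i).val = ∑ i : Fin n, i.val := Equiv.sum_comp π fun i : Fin n => (i : ℕ)
  exact Fin.ext ((Finset.sum_eq_sum_iff_of_le (f := fun i => (π i).val) (g := fun i => i.val)
    fun i _ => h i).1 hsum i (Finset.mem_univ i))

/-- If the closed parent sets form a lower triangular pattern under separate orderings `σ`, `τ` of
the rows and columns, then `σ = τ`, since each vertex lies in its own closed parent set, and the
graph is acyclic. -/
theorem isDAG_of_triangular {G : Digraph (Fin n)} (hloop : ∀ i, ¬ G.Adj i i)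
    (σ τ : Equiv.Perm (Fin n)) (h : ∀ i j, i < j → σ i ∉ closedParents G (τ j)) : IsDAG G := by
  have hle : ∀ a b, a ∈ closedParents G b → τ.symm b ≤ σ.symm a := by
    intro a b hab
    by_contra! hlt
    exact h _ _ hlt (by simpa using hab)
  have heq : ∀ a, τ.symm a = σ.symm a := fun a => by
    simpa using perm_apply_eq_of_le (σ.trans τ.symm)
      (fun i => by simpa using hle (σ i) (σ i) (.inl rfl)) (σ.symm a)
  -- Edges point from later to earlier positions in a lower triangular pattern.
  refine isDAG_of_rank (fun v => -((σ.symm v : ℕ) : ℤ)) fun a b hab => ?_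
  have hba : σ.symm b ≤ σ.symm a := heq b ▸ hle a b (.inr hab)
  have hne : σ.symm b ≠ σ.symm a := fun e => hloop a (by simpa [σ.symm.injective e] using hab)
  have hlt : σ.symm b < σ.symm a := lt_of_le_of_ne hba hne
  omega

theorem IsDAG.exists_triangular {G : Digraph (Fin n)} (hG : IsDAG G) :
    ∃ σ : Equiv.Perm (Fin n), ∀ i j, i < j → σ i ∉ closedParents G (σ j) := by
  obtain ⟨f, hf⟩ := hG.exists_rank
  refine ⟨Tuple.sort fun v => -f v, fun i j hij => ?_⟩
  rintro (he | hadj)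
  · exact hij.ne ((Tuple.sort fun v => -f v).injective he)
  · have hmono := Tuple.monotone_sort (fun v => -f v) hij.le
    simp only [Function.comp_apply, neg_le_neg_iff] at hmono
    exact (hf _ _ hadj).not_ge hmono

end Matrices

end SparseICA

theorem mainTheorem8 (n : ℕ) (A B Ω : Matrix (Fin n) (Fin n) ℝ)
    (hB : ∀ i, B i i = 0) (hΩ : SparseICA.IsPosDiagonal Ω)
    (hA : SparseICA.SignedColPermEquiv A ((1 - B) * SparseICA.invSqrtDiag Ω)) :
    (SparseICA.StructuralVariability A ∧ SparseICA.PermutableToLowerTriangular A) ↔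
      (SparseICA.IsDAG (SparseICA.graphOf B) ∧
        ∃ G, SparseICA.markovEquivalenceClass (SparseICA.graphOf B) = {G}) := by
  open SparseICA in
  obtain ⟨ρ, hρ⟩ := hA.exists_ne_zero_iff hB hΩ
  have hcol : ∀ j, colSupport A j = closedParents (graphOf B) (ρ j) := fun j =>
    Set.ext fun k => hρ k j
  have hzero : ∀ k j, A k j = 0 ↔ k ∉ closedParents (graphOf B) (ρ j) := fun k j =>
    not_iff_comm.1 (hρ k j) |>.symm
  have hSV : StructuralVariability A ↔ ∀ i j, i ≠ j →
      (symmDiff (closedParents (graphOf B) i) (closedParents (graphOf B) j)).Nontrivial := by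
    simp only [StructuralVariability, one_lt_ncard_union_sub_ncard_inter_iff, hcol]
    refine ⟨fun h i j hij => ?_, fun h i j hij => h _ _ (ρ.injective.ne hij)⟩
    simpa using h (ρ.symm i) (ρ.symm j) (ρ.symm.injective.ne hij)
  have hLT : PermutableToLowerTriangular A ↔ IsDAG (graphOf B) := by
    rw [permutableToLowerTriangular_iff]
    simp only [hzero]
    constructor
    · rintro ⟨σ, τ, h⟩
      exact isDAG_of_triangular (fun i hi => hi (hB i)) σ (τ.trans ρ) h
    · intro hG
      obtain ⟨σ, h⟩ := hG.exists_triangular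
      exact ⟨σ, σ.trans ρ.symm, by simpa using h⟩
  rw [hSV, hLT, and_comm]
  exact and_congr_right fun hG => (forall_nontrivial_iff_no_coveredEdge hG).trans
    (exists_markovEquivalenceClass_eq_singleton_iff hG).symm
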